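/- Let $\alpha>1$ be a real number and let $m_1, m_\alpha$ be real numbers with $m_1>0$ and $m_\alpha>m_1^{\alpha}$. Let $\mathcal F_{1,\alpha}$ be the set of all Borel probability measures $F$ on $[0,\infty)$ with $\int_0^\infty w\,\mathrm dF(w)=m_1$ and $\int_0^\infty w^{\alpha}\,\mathrm dF(w)=m_\alpha$. For $q\ge 0$ put $$\Pi_{1,\alpha}(q)=\sup_{F\in\mathcal F_{1,\alpha}}\mathbb E_F[(\tilde d-q)_+]=\sup_{F\in\mathcal F_{1,\alpha}}\int_0^\infty \max(w-q,0)\,\mathrm dF(w).$$ A function $u:[0,\infty)\to[0,\infty)$ is called regularly varying (at infinity) with index $\rho\in\mathbb R$ if $\lim_{x\to\infty}u(tx)/u(x)=t^{\rho}$ for every $t>0$. Then: (a) The function $\Pi_{1,\alpha}$ is finite-valued and regularly varying with index $-(\alpha-1)$. (b) There is a probability distribution $F^*$ on $[0,\infty)$ that does not belong to $\mathcal F_{1,\alpha}$ such that, for $\tilde d^*\sim F^*$, $$\mathbb E_{F^*}[(\tilde d^*-q)_+]=\Pi_{1,\alpha}(q)\qquad\text{for all } q\ge 0.$$ Moreover,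 the tail $\overline F^*(x)=F^*((x,\infty))$ is regularly varying with index $-\alpha$, $\mathbb E_{F^*}[(\tilde d^*)^{\alpha_1}]<\infty$ for all $0\le\alpha_1<\alpha$, and $\mathbb E_{F^*}[(\tilde d^*)^{\alpha_1}]=\infty$ for all $\alpha_1\ge\alpha$. -/

import Mathlib

open MeasureTheory ProbabilityTheory Filter Topology

/-- The ambiguity set: Borel probability measures on the nonnegative half-line (encoded as
measures on `ℝ` giving no mass to the negative numbers) whose first moment is `m₁` and whose
moment of order `α` is `mα`. -/
def ambiguitySet (m₁ α mα : ℝ) : Set (Measure ℝ) :=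
  {F | IsProbabilityMeasure F ∧ F (Set.Iio 0) = 0 ∧
    (Integrable (fun w : ℝ => w) F ∧ ∫ w, w ∂F = m₁) ∧
    (Integrable (fun w : ℝ => w ^ α) F ∧ ∫ w, w ^ α ∂F = mα)}

/-- The expected excess of a demand with distribution `F` over the order quantity `q`. -/
noncomputable def expectedExcess (F : Measure ℝ) (q : ℝ) : ℝ :=
  ∫ w, max (w - q) 0 ∂F

/-- The worst-case expected excess over the ambiguity set, as a function of `q`. -/
noncomputable def worstCase (m₁ α mα q : ℝ) : ℝ :=
  sSup ((fun F => expectedExcess F q) '' ambiguitySet m₁ α mα)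

/-- A function that is nonnegative on the nonnegative half-line is regularly varying at infinity
with index `ρ` if `u (t x) / u x → t ^ ρ` as `x → ∞`, for every `t > 0`. (The limit is positive, so
`u` cannot vanish at arbitrarily large arguments.) -/
def RegularlyVarying (u : ℝ → ℝ) (ρ : ℝ) : Prop :=
  (∀ x, 0 ≤ x → 0 ≤ u x) ∧
    ∀ t, 0 < t → Tendsto (fun x => u (t * x) / u x) atTop (𝓝 (t ^ ρ))

/-! Write `W` for the worst case. It is a supremum of functions convex in `q`, equals `m₁ - q` for
`q ≤ 0`, and vanishes at infinity. Any such function is the expected excess of a single law, with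
distribution function one plus the right derivative (`ConvexOn.exists_measure_expectedExcess_eq`).
That law is `F*`; the rest is read off from the asymptotics of `W`.

By `tendsto_worstCase_mul_rpow`, `W q * q ^ (α - 1)` tends to `K = (mα - m₁ ^ α) * excessConstant
α`. Upper bound: `w - q ≤ excessConstant α * q ^ (1 - α) * w ^ α`, and for large `w` one may replace
`w ^ α`, up to a factor near 1, by its gap above the tangent at `m₁`, whose mean is `mα - m₁ ^ α`
under every admissible law. Lower bound: two-point laws with a far atom at `α / (α - 1) * q`.

Convexity allows this asymptotic to be differentiated (`tendsto_subgradient_mul_rpow`): the tail of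
`F*` is asymptotic to `K * (α - 1) * x ^ (-α)`. Layer-cake integrals then decide the moments, and
the infinite moment of order `α` keeps `F*` out of the ambiguity set. -/

/-! ### Power asymptotics and right derivatives of convex functions. -/

lemma regularlyVarying_of_tendsto_mul_rpow {u : ℝ → ℝ} {ρ K : ℝ} (hK : K ≠ 0)
    (hu : ∀ x, 0 ≤ x → 0 ≤ u x)
    (h : Tendsto (fun x => u x * x ^ (-ρ)) atTop (𝓝 K)) : RegularlyVarying u ρ := by
  refine ⟨hu, fun t ht => ?_⟩
  have h1 : Tendsto (fun x => u (t * x) * (t * x) ^ (-ρ)) atTop (𝓝 K) :=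
    h.comp (tendsto_id.const_mul_atTop ht)
  have h2 := (h1.div h hK).const_mul (t ^ ρ)
  rw [div_self hK, mul_one] at h2
  refine h2.congr' ?_
  filter_upwards [eventually_gt_atTop 0] with x hx
  have hx' : x ^ (-ρ) ≠ 0 := (Real.rpow_pos_of_pos hx _).ne'
  have ht' : t ^ ρ ≠ 0 := (Real.rpow_pos_of_pos ht _).ne'
  simp only [Pi.div_apply]
  rw [Real.mul_rpow ht.le hx.le, Real.rpow_neg ht.le,
    show u (t * x) * ((t ^ ρ)⁻¹ * x ^ (-ρ)) = (u (t * x) * (t ^ ρ)⁻¹) * x ^ (-ρ) by ring,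
    mul_div_mul_right _ _ hx']
  field_simp

/-- The monotone density theorem for power asymptotics, with the density given as a family of
subgradients. -/
lemma tendsto_subgradient_mul_rpow {f d : ℝ → ℝ} {β K : ℝ}
    (hS : ∀ x y, f x + d x * (y - x) ≤ f y)
    (h : Tendsto (fun x => f x * x ^ β) atTop (𝓝 K)) :
    Tendsto (fun x => -d x * x ^ (β + 1)) atTop (𝓝 (K * β)) := by
  have hder : HasDerivAt (fun s : ℝ => s ^ (-β)) (-β) 1 := by
    simpa using Real.hasDerivAt_rpow_const (x := (1 : ℝ)) (p := -β) (Or.inl one_ne_zero)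
  have hslope := (hasDerivAt_iff_tendsto_slope.1 hder).const_mul (-K)
  have hKβ : -K * -β = K * β := by ring
  rw [hKβ] at hslope
  have hlim : ∀ s : ℝ, 0 < s →
      Tendsto (fun x => f (s * x) * x ^ β - f x * x ^ β) atTop (𝓝 (K * (s ^ (-β) - 1))) := by
    intro s hs
    have h1 : Tendsto (fun x => f (s * x) * (s * x) ^ β) atTop (𝓝 K) :=
      h.comp (tendsto_id.const_mul_atTop hs)
    have h2 := (h1.const_mul (s ^ (-β))).sub h
    rw [show s ^ (-β) * K - K = K * (s ^ (-β) - 1) by ring] at h2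
    refine h2.congr' ?_
    filter_upwards [eventually_gt_atTop 0] with x hx
    have hs' : s ^ β ≠ 0 := (Real.rpow_pos_of_pos hs _).ne'
    rw [Real.mul_rpow hs.le hx.le, Real.rpow_neg hs.le]
    field_simp
  -- The subgradient inequality between `x` and `s * x`: dividing by `1 - s` bounds the density
  -- below for `s > 1` and above for `s < 1`. Both bounds tend to `K * β` as `s → 1`, after `x → ∞`.
  have hineq : ∀ s x : ℝ, 0 < x →
      -d x * x ^ (β + 1) * (1 - s) ≤ f (s * x) * x ^ β - f x * x ^ β := by
    intro s x hx
    have h1 := mul_le_mul_of_nonneg_right (hS x (s * x)) (Real.rpow_pos_of_pos hx β).le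
    rw [Real.rpow_add_one hx.ne']
    nlinarith
  refine tendsto_order.2 ⟨fun c hc => ?_, fun c hc => ?_⟩
  · have h1 : ∀ᶠ s in 𝓝[>] (1 : ℝ), c < -K * slope (fun s : ℝ => s ^ (-β)) 1 s :=
      (hslope.mono_left (nhdsWithin_mono _ fun s hs => ne_of_gt hs)).eventually_const_lt hc
    obtain ⟨s, hs, hs1⟩ := (h1.and self_mem_nhdsWithin).exists
    have hs1' : (1 : ℝ) < s := hs1
    rw [slope_def_field, Real.one_rpow, ← mul_div_assoc, lt_div_iff₀ (by linarith)] at hs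
    have h2 : K * (s ^ (-β) - 1) < c * (1 - s) := by linarith
    filter_upwards [(hlim s (by linarith)).eventually_lt_const h2, eventually_gt_atTop 0]
      with x hx hx0
    have h3 := hineq s x hx0
    nlinarith
  · have h1 : ∀ᶠ s in 𝓝[<] (1 : ℝ), -K * slope (fun s : ℝ => s ^ (-β)) 1 s < c :=
      (hslope.mono_left (nhdsWithin_mono _ fun s hs => ne_of_lt hs)).eventually_lt_const hc
    have h0 : ∀ᶠ s in 𝓝[<] (1 : ℝ), 0 < s :=
      eventually_nhdsWithin_of_eventually_nhds (lt_mem_nhds one_pos)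
    obtain ⟨s, ⟨hs, hs0⟩, hs1⟩ := ((h1.and h0).and self_mem_nhdsWithin).exists
    have hs1' : s < (1 : ℝ) := hs1
    rw [slope_comm, slope_def_field, Real.one_rpow, ← mul_div_assoc,
      div_lt_iff₀ (by linarith)] at hs
    have h2 : K * (s ^ (-β) - 1) < c * (1 - s) := by linarith
    filter_upwards [(hlim s hs0).eventually_lt_const h2, eventually_gt_atTop 0] with x hx hx0
    have h3 := hineq s x hx0
    nlinarith

lemma ConvexOn.add_rightDeriv_mul_le {f : ℝ → ℝ} (hf : ConvexOn ℝ Set.univ f) (x y : ℝ) :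
    f x + derivWithin f (Set.Ioi x) x * (y - x) ≤ f y := by
  have hx : x ∈ interior (Set.univ : Set ℝ) := by simp
  rcases lt_trichotomy x y with h | rfl | h
  · have h1 := hf.rightDeriv_le_slope_of_mem_interior hx (Set.mem_univ y) h
    rw [slope_def_field, le_div_iff₀ (by linarith)] at h1
    linarith
  · simp
  · have h1 := (hf.slope_le_leftDeriv_of_mem_interior (Set.mem_univ y) hx h).trans
      (hf.leftDeriv_le_rightDeriv_of_mem_interior hx)
    rw [slope_def_field, div_le_iff₀ (by linarith)] at h1
    linarith

/-- The right derivative is monotone, and it is an infimum of slopes to points on the right. Each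
such slope is continuous in its base point, which gives the upper bound. -/
lemma ConvexOn.continuousWithinAt_rightDeriv {f : ℝ → ℝ} (hf : ConvexOn ℝ Set.univ f) (x : ℝ) :
    ContinuousWithinAt (fun x => derivWithin f (Set.Ioi x) x) (Set.Ici x) x := by
  have hint : ∀ x, x ∈ interior (Set.univ : Set ℝ) := by simp
  have hcont : Continuous f := by
    rw [← continuousOn_univ]
    exact hf.continuousOn isOpen_univ
  refine tendsto_order.2 ⟨fun c hc => ?_, fun c hc => ?_⟩
  · filter_upwards [self_mem_nhdsWithin] with y hy
    exact hc.trans_le (hf.monotoneOn_rightDeriv (hint x) (hint y) hy)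
  · have h1 := hasDerivWithinAt_iff_tendsto_slope.1
      (hf.hasDerivWithinAt_rightDeriv_of_mem_interior (hint x))
    rw [Set.sdiff_singleton_eq_self (by simp)] at h1
    obtain ⟨y, hy, hxy⟩ := ((h1.eventually_lt_const hc).and self_mem_nhdsWithin).exists
    have hxy' : x < y := hxy
    have h2 : ContinuousAt (fun t => slope f t y) x := by
      simp only [slope_def_field]
      exact (continuousAt_const.sub hcont.continuousAt).div
        (continuousAt_const.sub continuousAt_id) (by simp [sub_ne_zero, hxy'.ne'])
    have h3 : ∀ᶠ t in 𝓝[≥] x, slope f t y < c :=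
      eventually_nhdsWithin_of_eventually_nhds (h2.eventually_lt_const hy)
    have h4 : ∀ᶠ t in 𝓝[≥] x, t < y :=
      eventually_nhdsWithin_of_eventually_nhds (gt_mem_nhds hxy')
    filter_upwards [h3, h4] with t ht hty
    exact (hf.rightDeriv_le_slope_of_mem_interior (hint t) (Set.mem_univ y) hty).trans_lt ht

/-- The fundamental theorem of calculus on a half-line for a nonincreasing convex function
vanishing at infinity. -/
lemma ConvexOn.lintegral_Ioi_neg_rightDeriv {f : ℝ → ℝ} (hf : ConvexOn ℝ Set.univ f)
    (hneg : ∀ x, derivWithin f (Set.Ioi x) x ≤ 0) (h0 : Tendsto f atTop (𝓝 0)) (q : ℝ) :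
    ∫⁻ x in Set.Ioi q, ENNReal.ofReal (-derivWithin f (Set.Ioi x) x) = ENNReal.ofReal (f q) := by
  have hint : ∀ x, x ∈ interior (Set.univ : Set ℝ) := by simp
  have hcont : Continuous f := by
    rw [← continuousOn_univ]
    exact hf.continuousOn isOpen_univ
  have hmono : Monotone (fun x => derivWithin f (Set.Ioi x) x) :=
    fun x y hxy => hf.monotoneOn_rightDeriv (hint x) (hint y) hxy
  have hFTC : ∀ b, ∫ x in q..b, -derivWithin f (Set.Ioi x) x = f q - f b := by
    intro b
    rw [intervalIntegral.integral_neg, intervalIntegral.integral_eq_sub_of_hasDeriv_right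
      hcont.continuousOn (fun x _ => hf.hasDerivWithinAt_rightDeriv_of_mem_interior (hint x))
      hmono.intervalIntegrable]
    ring
  have hlim : Tendsto (fun b => ∫ x in q..b, -derivWithin f (Set.Ioi x) x) atTop (𝓝 (f q)) := by
    simp only [hFTC]
    simpa using h0.const_sub (f q)
  have hI : IntegrableOn (fun x => -derivWithin f (Set.Ioi x) x) (Set.Ioi q) := by
    refine integrableOn_Ioi_of_intervalIntegral_norm_tendsto (f q) q (fun b => ?_) tendsto_id ?_
    · exact (hmono.neg.intervalIntegrable (a := q) (b := b)).1
    · refine hlim.congr fun b => intervalIntegral.integral_congr fun x _ => ?_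
      exact (Real.norm_of_nonneg (by linarith [hneg x])).symm
  rw [← ofReal_integral_eq_lintegral_ofReal hI (ae_of_all _ fun x => by simpa using hneg x)]
  rw [tendsto_nhds_unique (intervalIntegral_tendsto_integral_Ioi q hI tendsto_id) hlim]

/-! ### The worst case: finiteness, convexity, two-point laws and sharp asymptotics. -/

section AmbiguitySet

variable {m₁ α mα : ℝ} {F : Measure ℝ}

lemma ae_nonneg_of_measure_Iio_zero {F : Measure ℝ} (h : F (Set.Iio 0) = 0) :
    ∀ᵐ w ∂F, 0 ≤ w := by
  rw [ae_iff]
  simpa [Set.Iio] using h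

lemma integrable_excess (hF : F ∈ ambiguitySet m₁ α mα) (q : ℝ) :
    Integrable (fun w : ℝ => max (w - q) 0) F := by
  have := hF.1
  exact (hF.2.2.1.1.sub (integrable_const q)).sup (integrable_const 0)

lemma expectedExcess_le (hF : F ∈ ambiguitySet m₁ α mα) (q : ℝ) :
    expectedExcess F q ≤ m₁ + |q| := by
  have := hF.1
  have h1 : Integrable (fun w : ℝ => w + |q|) F := hF.2.2.1.1.add (integrable_const _)
  calc expectedExcess F q ≤ ∫ w, (w + |q|) ∂F := by
        refine integral_mono_ae (integrable_excess hF q) h1 ?_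
        filter_upwards [ae_nonneg_of_measure_Iio_zero hF.2.1] with w hw
        exact max_le (by linarith [neg_abs_le q]) (by positivity)
    _ = m₁ + |q| := by
        rw [integral_add hF.2.2.1.1 (integrable_const _), hF.2.2.1.2]
        simp

lemma bddAbove_expectedExcess (m₁ α mα q : ℝ) :
    BddAbove ((fun F => expectedExcess F q) '' ambiguitySet m₁ α mα) :=
  ⟨m₁ + |q|, by rintro _ ⟨F, hF, rfl⟩; exact expectedExcess_le hF q⟩

lemma expectedExcess_le_worstCase (hF : F ∈ ambiguitySet m₁ α mα) (q : ℝ) :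
    expectedExcess F q ≤ worstCase m₁ α mα q :=
  le_csSup (bddAbove_expectedExcess m₁ α mα q) (Set.mem_image_of_mem _ hF)

lemma expectedExcess_of_nonpos (hF : F ∈ ambiguitySet m₁ α mα) {q : ℝ} (hq : q ≤ 0) :
    expectedExcess F q = m₁ - q := by
  have := hF.1
  have h1 : expectedExcess F q = ∫ w, (w - q) ∂F := by
    refine integral_congr_ae ?_
    filter_upwards [ae_nonneg_of_measure_Iio_zero hF.2.1] with w hw
    exact max_eq_left (by linarith)
  rw [h1, integral_sub hF.2.2.1.1 (integrable_const _), hF.2.2.1.2]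
  simp

lemma worstCase_of_nonpos (hne : (ambiguitySet m₁ α mα).Nonempty) {q : ℝ} (hq : q ≤ 0) :
    worstCase m₁ α mα q = m₁ - q := by
  refine le_antisymm (csSup_le (hne.image _) ?_) ?_
  · rintro _ ⟨F, hF, rfl⟩
    exact (expectedExcess_of_nonpos hF hq).le
  · obtain ⟨F, hF⟩ := hne
    rw [← expectedExcess_of_nonpos hF hq]
    exact expectedExcess_le_worstCase hF q

lemma worstCase_nonneg (m₁ α mα q : ℝ) : 0 ≤ worstCase m₁ α mα q := by
  refine Real.sSup_nonneg ?_
  rintro _ ⟨F, -, rfl⟩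
  exact integral_nonneg fun w => le_max_right _ _

lemma convexOn_worstCase (hne : (ambiguitySet m₁ α mα).Nonempty) :
    ConvexOn ℝ Set.univ (worstCase m₁ α mα) := by
  refine ⟨convex_univ, fun x _ y _ a b ha hb hab => csSup_le (hne.image _) ?_⟩
  rintro _ ⟨F, hF, rfl⟩
  have hx := integrable_excess hF x
  have hy := integrable_excess hF y
  calc expectedExcess F (a • x + b • y)
      ≤ ∫ w, (a * max (w - x) 0 + b * max (w - y) 0) ∂F := by
        refine integral_mono (integrable_excess hF _)
          ((hx.const_mul a).add (hy.const_mul b)) fun w => max_le ?_ (by positivity)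
        have h1 := mul_le_mul_of_nonneg_left (le_max_left (w - x) 0) ha
        have h2 := mul_le_mul_of_nonneg_left (le_max_left (w - y) 0) hb
        simp only [smul_eq_mul]
        have h3 : (a + b) * w = w := by rw [hab, one_mul]
        linarith
    _ = a * expectedExcess F x + b * expectedExcess F y := by
        rw [integral_add (hx.const_mul a) (hy.const_mul b), integral_const_mul,
          integral_const_mul]
        rfl
    _ ≤ a • worstCase m₁ α mα x + b • worstCase m₁ α mα y := by
        simp only [smul_eq_mul]
        gcongr <;> exact expectedExcess_le_worstCase hF _

/-- The distribution with mass `1 - p` at `y` and mass `p` at `z`. -/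
noncomputable def twoPointMeasure (p y z : ℝ) : Measure ℝ :=
  ENNReal.ofReal (1 - p) • Measure.dirac y + ENNReal.ofReal p • Measure.dirac z

lemma integrable_twoPointMeasure (p y z : ℝ) (f : ℝ → ℝ) :
    Integrable f (twoPointMeasure p y z) :=
  ((integrable_dirac (by simp)).smul_measure ENNReal.ofReal_ne_top).add_measure
    ((integrable_dirac (by simp)).smul_measure ENNReal.ofReal_ne_top)

lemma integral_twoPointMeasure {p : ℝ} (hp0 : 0 ≤ p) (hp1 : p ≤ 1) (y z : ℝ) (f : ℝ → ℝ) :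
    ∫ w, f w ∂twoPointMeasure p y z = (1 - p) * f y + p * f z := by
  rw [twoPointMeasure, integral_add_measure
    ((integrable_dirac (by simp)).smul_measure ENNReal.ofReal_ne_top)
    ((integrable_dirac (by simp)).smul_measure ENNReal.ofReal_ne_top)]
  simp [integral_smul_measure, hp0, hp1]

lemma twoPointMeasure_mem_ambiguitySet {p y z : ℝ} (hp0 : 0 ≤ p) (hp1 : p ≤ 1) (hy : 0 ≤ y)
    (hz : 0 ≤ z) (h1 : (1 - p) * y + p * z = m₁) (hα : (1 - p) * y ^ α + p * z ^ α = mα) :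
    twoPointMeasure p y z ∈ ambiguitySet m₁ α mα := by
  refine ⟨⟨?_⟩, ?_, ⟨integrable_twoPointMeasure _ _ _ _, ?_⟩,
    ⟨integrable_twoPointMeasure _ _ _ _, ?_⟩⟩
  · simp [twoPointMeasure, ← ENNReal.ofReal_add (sub_nonneg.2 hp1) hp0]
  · simp [twoPointMeasure, hy, hz]
  · rw [integral_twoPointMeasure hp0 hp1, h1]
  · rw [integral_twoPointMeasure hp0 hp1, hα]

/-- With one atom at `z`, the mean fixes the other atom `y` in terms of the mass `p` at `z`. The
`α`-moment runs from `m₁ ^ α` at `p = 0` to `m₁ * z ^ (α - 1)` at `p = m₁ / z`, so it takes the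
value `mα`. Since `y ≤ m₁`, this forces `mα ≤ m₁ ^ α + p * z ^ α`, which bounds `p` below. -/
lemma exists_mem_ambiguitySet_le_expectedExcess (hα : 1 < α) (hm₁ : 0 < m₁) (hmα : m₁ ^ α < mα)
    {z : ℝ} (hz : m₁ < z) (hzα : mα ≤ m₁ * z ^ (α - 1)) :
    ∃ F ∈ ambiguitySet m₁ α mα, ∀ q, q ≤ z →
      (mα - m₁ ^ α) / z ^ α * (z - q) ≤ expectedExcess F q := by
  have hz0 : 0 < z := hm₁.trans hz
  have hzpos : 0 < z ^ α := Real.rpow_pos_of_pos hz0 _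
  have hlt : m₁ / z < 1 := (div_lt_one hz0).2 hz
  have hcont : ContinuousOn (fun p : ℝ => (1 - p) * ((m₁ - p * z) / (1 - p)) ^ α + p * z ^ α)
      (Set.Icc 0 (m₁ / z)) := by
    refine ContinuousOn.add (ContinuousOn.mul (by fun_prop) ?_) (by fun_prop)
    refine ContinuousOn.rpow_const (ContinuousOn.div (by fun_prop) (by fun_prop) ?_)
      fun _ _ => Or.inr (by linarith)
    intro p hp
    have := hp.2
    exact ne_of_gt (by linarith)
  have hsurj := intermediate_value_Icc (div_nonneg hm₁.le hz0.le) hcont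
  have hmem : mα ∈ Set.Icc
      ((1 - 0) * ((m₁ - 0 * z) / (1 - 0)) ^ α + 0 * z ^ α)
      ((1 - m₁ / z) * ((m₁ - m₁ / z * z) / (1 - m₁ / z)) ^ α + m₁ / z * z ^ α) := by
    constructor
    · simpa using hmα.le
    · rw [div_mul_cancel₀ _ hz0.ne', sub_self, zero_div, Real.zero_rpow (by linarith), mul_zero,
        zero_add, div_mul_eq_mul_div, mul_div_assoc, ← Real.rpow_sub_one hz0.ne']
      exact hzα
  obtain ⟨p, ⟨hp0, hp1⟩, hp⟩ := hsurj hmem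
  simp only at hp
  have hp1' : p < 1 := hp1.trans_lt hlt
  have h1p : 0 < 1 - p := by linarith
  have hpz : p * z ≤ m₁ := (le_div_iff₀ hz0).1 hp1
  set y := (m₁ - p * z) / (1 - p) with hy
  have hy0 : 0 ≤ y := div_nonneg (by linarith) h1p.le
  have hmean : (1 - p) * y + p * z = m₁ := by
    rw [hy, mul_div_cancel₀ _ h1p.ne']; ring
  have hym : y ≤ m₁ := by
    rw [hy, div_le_iff₀ h1p]
    nlinarith
  have hyα : y ^ α ≤ m₁ ^ α := Real.rpow_le_rpow hy0 hym (by linarith)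
  refine ⟨twoPointMeasure p y z,
    twoPointMeasure_mem_ambiguitySet hp0 hp1'.le hy0 hz0.le hmean hp, fun q hq => ?_⟩
  have hpD : (mα - m₁ ^ α) / z ^ α ≤ p := by
    rw [div_le_iff₀ hzpos]
    have := Real.rpow_nonneg hy0 α
    nlinarith
  rw [expectedExcess, integral_twoPointMeasure hp0 hp1'.le]
  have h1 : 0 ≤ (1 - p) * max (y - q) 0 := mul_nonneg h1p.le (le_max_right _ _)
  have h2 : p * (z - q) ≤ p * max (z - q) 0 := mul_le_mul_of_nonneg_left (le_max_left _ _) hp0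
  have h3 := mul_le_mul_of_nonneg_right hpD (sub_nonneg.2 hq)
  linarith

lemma eventually_le_mul_rpow_sub_one (hα : 1 < α) (hm₁ : 0 < m₁) (mα : ℝ) :
    ∀ᶠ z : ℝ in atTop, m₁ < z ∧ mα ≤ m₁ * z ^ (α - 1) :=
  (eventually_gt_atTop m₁).and
    (((tendsto_rpow_atTop (by linarith)).const_mul_atTop hm₁).eventually_ge_atTop mα)

lemma ambiguitySet_nonempty (hα : 1 < α) (hm₁ : 0 < m₁) (hmα : m₁ ^ α < mα) :
    (ambiguitySet m₁ α mα).Nonempty := by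
  obtain ⟨z, hz, hzα⟩ := (eventually_le_mul_rpow_sub_one hα hm₁ mα).exists
  obtain ⟨F, hF, -⟩ := exists_mem_ambiguitySet_le_expectedExcess hα hm₁ hmα hz hzα
  exact ⟨F, hF⟩

/-- The optimal constant in `w - q ≤ C * q ^ (1 - α) * w ^ α`, attained at `w = α / (α - 1) * q`. -/
noncomputable def excessConstant (α : ℝ) : ℝ :=
  (α / (α - 1) - 1) * (α / (α - 1)) ^ (-α)

lemma excessConstant_pos (hα : 1 < α) : 0 < excessConstant α := by
  have h : 1 < α / (α - 1) := (one_lt_div (by linarith)).2 (by linarith)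
  exact mul_pos (by linarith) (Real.rpow_pos_of_pos (by linarith) _)

lemma excessConstant_mul_rpow (hα : 1 < α) {q : ℝ} (hq : 0 < q) :
    excessConstant α * q ^ (1 - α) =
      (α / (α - 1) * q - q) / (α / (α - 1) * q) ^ α := by
  have h : 0 < α / (α - 1) := div_pos (by linarith) (by linarith)
  rw [excessConstant, Real.mul_rpow h.le hq.le, Real.rpow_neg h.le, sub_eq_add_neg 1 α,
    Real.rpow_add hq, Real.rpow_one, Real.rpow_neg hq.le]
  field_simp

/-- Bernoulli's inequality is the tangent-line bound for `w ^ α` at `z = α / (α - 1) * q`, and that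
tangent crosses zero exactly at `q`. -/
lemma sub_le_excessConstant_mul (hα : 1 < α) {q w : ℝ} (hq : 0 < q) (hw : 0 ≤ w) :
    w - q ≤ excessConstant α * q ^ (1 - α) * w ^ α := by
  have hα1 : 0 < α - 1 := by linarith
  rw [excessConstant_mul_rpow hα hq]
  set z := α / (α - 1) * q with hz
  have hz0 : 0 < z := by positivity
  have hzq : z - q = z / α := by
    rw [hz]; field_simp; ring
  have hB := one_add_mul_self_le_rpow_one_add
    (s := w / z - 1) (by linarith [div_nonneg hw hz0.le]) hα.le
  rw [add_sub_cancel, Real.div_rpow hw hz0.le] at hB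
  calc w - q = z / α * (1 + α * (w / z - 1)) := by
        rw [show q = z - z / α by linarith]; field_simp; ring
    _ ≤ z / α * (w ^ α / z ^ α) := by gcongr
    _ = (z - q) / z ^ α * w ^ α := by rw [hzq]; ring

lemma tangent_le_rpow (hα : 1 < α) (hm₁ : 0 < m₁) {w : ℝ} (hw : 0 ≤ w) :
    m₁ ^ α + α * m₁ ^ (α - 1) * (w - m₁) ≤ w ^ α := by
  have hB := one_add_mul_self_le_rpow_one_add
    (s := w / m₁ - 1) (by linarith [div_nonneg hw hm₁.le]) hα.le
  have hp := Real.rpow_pos_of_pos hm₁ α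
  rw [add_sub_cancel, Real.div_rpow hw hm₁.le, le_div_iff₀ hp] at hB
  rw [Real.rpow_sub_one hm₁.ne']
  calc _ = (1 + α * (w / m₁ - 1)) * m₁ ^ α := by field_simp
    _ ≤ _ := hB

/-- The tangent is affine, hence negligible against `w ^ α`: the ratio of the gap to `w ^ α` tends
to 1. -/
lemma eventually_rpow_le_mul_tangent_gap (hα : 1 < α) (m₁ : ℝ) {r : ℝ} (hr : 1 < r) :
    ∀ᶠ w : ℝ in atTop,
      w ^ α ≤ r * (w ^ α - (m₁ ^ α + α * m₁ ^ (α - 1) * (w - m₁))) := by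
  set c := α * m₁ ^ (α - 1)
  have h0 : Tendsto (fun w : ℝ => w ^ (-α)) atTop (𝓝 0) := tendsto_rpow_neg_atTop (by linarith)
  have h1 : Tendsto (fun w : ℝ => w ^ (-(α - 1))) atTop (𝓝 0) :=
    tendsto_rpow_neg_atTop (by linarith)
  have h2 : Tendsto (fun w : ℝ => r * (1 - ((m₁ ^ α - c * m₁) * w ^ (-α) + c * w ^ (-(α - 1)))))
      atTop (𝓝 (r * (1 - ((m₁ ^ α - c * m₁) * 0 + c * 0)))) :=
    (((h0.const_mul _).add (h1.const_mul _)).const_sub 1).const_mul r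
  filter_upwards [h2.eventually_const_lt (u := 1) (by simpa using hr), eventually_gt_atTop 0]
    with w hw hw0
  have hp := Real.rpow_pos_of_pos hw0 α
  have h3 := mul_le_mul_of_nonneg_right hw.le hp.le
  rw [neg_sub, sub_eq_add_neg 1 α, Real.rpow_add hw0, Real.rpow_one, Real.rpow_neg hw0.le] at h3
  calc w ^ α = 1 * w ^ α := (one_mul _).symm
    _ ≤ _ := h3
    _ = _ := by field_simp; ring

lemma tendsto_worstCase_mul_rpow (hα : 1 < α) (hm₁ : 0 < m₁) (hmα : m₁ ^ α < mα) :
    Tendsto (fun q => worstCase m₁ α mα q * q ^ (α - 1)) atTop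
      (𝓝 ((mα - m₁ ^ α) * excessConstant α)) := by
  have hC := excessConstant_pos hα
  have hD : 0 < mα - m₁ ^ α := by linarith
  have hne := ambiguitySet_nonempty hα hm₁ hmα
  have hcancel : ∀ q : ℝ, 0 < q → q ^ (1 - α) * q ^ (α - 1) = 1 := fun q hq => by
    rw [← Real.rpow_add hq]; simp
  refine tendsto_order.2 ⟨fun c hc => ?_, fun c hc => ?_⟩
  · have ha : 1 < α / (α - 1) := (one_lt_div (by linarith)).2 (by linarith)
    have hev := (tendsto_id.const_mul_atTop (by linarith : 0 < α / (α - 1))).eventually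
      (eventually_le_mul_rpow_sub_one hα hm₁ mα)
    filter_upwards [hev, eventually_gt_atTop 0] with q hq hq0
    obtain ⟨F, hF, hle⟩ := exists_mem_ambiguitySet_le_expectedExcess hα hm₁ hmα hq.1 hq.2
    have h1 := (hle q (by simp only [id]; nlinarith)).trans (expectedExcess_le_worstCase hF q)
    simp only [id] at h1
    rw [div_mul_eq_mul_div, mul_div_assoc, ← excessConstant_mul_rpow hα hq0] at h1
    have h2 := mul_le_mul_of_nonneg_right h1 (Real.rpow_pos_of_pos hq0 (α - 1)).le
    refine hc.trans_le (le_trans (le_of_eq ?_) h2)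
    linear_combination -((mα - m₁ ^ α) * excessConstant α) * hcancel q hq0
  · set K := (mα - m₁ ^ α) * excessConstant α
    have hK : 0 < K := mul_pos hD hC
    obtain ⟨r, hr1, hrc⟩ := exists_between ((one_lt_div hK).2 hc)
    rw [lt_div_iff₀ hK] at hrc
    obtain ⟨N, hN⟩ := eventually_atTop.1 (eventually_rpow_le_mul_tangent_gap hα m₁ hr1)
    filter_upwards [eventually_ge_atTop N, eventually_gt_atTop 0] with q hqN hq0
    have hq' := Real.rpow_pos_of_pos hq0 (1 - α)
    have hle : worstCase m₁ α mα q ≤ excessConstant α * q ^ (1 - α) * (r * (mα - m₁ ^ α)) := by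
      refine csSup_le (hne.image _) ?_
      rintro _ ⟨F, hF, rfl⟩
      have := hF.1
      have hI1 : Integrable (fun w : ℝ => α * m₁ ^ (α - 1) * (w - m₁)) F :=
        (hF.2.2.1.1.sub (integrable_const _)).const_mul _
      have hI2 : Integrable (fun w : ℝ => m₁ ^ α + α * m₁ ^ (α - 1) * (w - m₁)) F :=
        (integrable_const _).add hI1
      -- The two moment constraints make this mean the same for every admissible law.
      have hgap : ∫ w, (w ^ α - (m₁ ^ α + α * m₁ ^ (α - 1) * (w - m₁))) ∂F = mα - m₁ ^ α := by
        rw [integral_sub hF.2.2.2.1 hI2, hF.2.2.2.2, integral_add (integrable_const _) hI1,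
          integral_const_mul, integral_sub hF.2.2.1.1 (integrable_const _), hF.2.2.1.2]
        simp
      rw [← hgap, ← integral_const_mul, ← integral_const_mul]
      refine integral_mono_ae (integrable_excess hF q)
        (((hF.2.2.2.1.sub hI2).const_mul _).const_mul _) ?_
      filter_upwards [ae_nonneg_of_measure_Iio_zero hF.2.1] with w hw
      have hgap0 := tangent_le_rpow hα hm₁ hw
      refine max_le ?_ (mul_nonneg (by positivity)
        (mul_nonneg (by linarith) (by linarith)))
      -- Below `q` the excess vanishes and nonnegativity of the gap suffices; above `q ≥ N` the gap
      -- dominates `w ^ α / r`.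
      rcases le_total w q with hwq | hwq
      · exact (sub_nonpos.2 hwq).trans (mul_nonneg (by positivity)
          (mul_nonneg (by linarith) (by linarith)))
      · exact (sub_le_excessConstant_mul hα hq0 hw).trans
          (mul_le_mul_of_nonneg_left (hN w (hqN.trans hwq)) (by positivity))
    have h2 := mul_le_mul_of_nonneg_right hle (Real.rpow_pos_of_pos hq0 (α - 1)).le
    refine h2.trans_lt (lt_of_eq_of_lt ?_ hrc)
    linear_combination (r * ((mα - m₁ ^ α) * excessConstant α)) * hcancel q hq0

lemma isLUB_worstCase (hne : (ambiguitySet m₁ α mα).Nonempty) (q : ℝ) :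
    IsLUB ((fun F => expectedExcess F q) '' ambiguitySet m₁ α mα) (worstCase m₁ α mα q) :=
  isLUB_csSup (hne.image _) (bddAbove_expectedExcess m₁ α mα q)

end AmbiguitySet

/-! ### Moments and expected excess from the tail. -/

section Moments

variable {μ : Measure ℝ} {h : ℝ → ℝ} {α L p : ℝ}

/-- Layer cake: near zero the tail is at most 1 and `t ^ (p - 1)` is integrable for `p > 0`; far out
the integrand is at most `(L + 1) * t ^ (p - 1 - α)`, with exponent below `-1`. -/
lemma lintegral_rpow_lt_top_of_tail [IsProbabilityMeasure μ] (hμ : μ (Set.Iio 0) = 0)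
    (htail : ∀ t, μ (Set.Ioi t) = ENNReal.ofReal (h t))
    (hlim : Tendsto (fun x => h x * x ^ α) atTop (𝓝 L)) (hp : 0 ≤ p) (hpα : p < α) :
    ∫⁻ w, ENNReal.ofReal (w ^ p) ∂μ < ⊤ := by
  rcases hp.eq_or_lt with rfl | hp
  · simp
  rw [lintegral_rpow_eq_lintegral_meas_lt_mul μ (f := fun w => w)
    (ae_nonneg_of_measure_Iio_zero hμ) aemeasurable_id hp]
  obtain ⟨N, hN⟩ := eventually_atTop.1
    ((hlim.eventually_lt_const (lt_add_one L)).and (eventually_gt_atTop 0))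
  have hN0 : 0 < N := (hN N le_rfl).2
  refine ENNReal.mul_lt_top ENNReal.ofReal_lt_top ?_
  rw [← Set.Ioc_union_Ioi_eq_Ioi hN0.le]
  refine (lintegral_union_le _ _ _).trans_lt (ENNReal.add_lt_top.2 ⟨?_, ?_⟩)
  · have hI : IntegrableOn (fun t : ℝ => t ^ (p - 1)) (Set.Ioc 0 N) :=
      (intervalIntegral.intervalIntegrable_rpow' (by linarith)).1
    refine lt_of_le_of_lt (lintegral_mono fun t => ?_) hI.lintegral_lt_top
    exact mul_le_of_le_one_left' prob_le_one
  · have hI : IntegrableOn (fun t : ℝ => (L + 1) * t ^ (p - 1 - α)) (Set.Ioi N) :=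
      (integrableOn_Ioi_rpow_of_lt (by linarith) hN0).const_mul _
    refine lt_of_le_of_lt (setLIntegral_mono_ae' measurableSet_Ioi (ae_of_all _ fun t ht => ?_))
      hI.lintegral_lt_top
    obtain ⟨h1, ht0⟩ := hN t (le_of_lt ht)
    have htp := Real.rpow_pos_of_pos ht0 (p - 1)
    rw [show {a | t < a} = Set.Ioi t from rfl, htail,
      ← ENNReal.ofReal_mul' htp.le]
    refine ENNReal.ofReal_le_ofReal ?_
    have htα := Real.rpow_pos_of_pos ht0 α
    rw [Real.rpow_sub ht0 (p - 1) α, ← mul_div_assoc, le_div_iff₀ htα]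
    nlinarith

/-- Here the layer-cake integrand eventually exceeds `L / 2 * t ^ (p - 1 - α)`, whose exponent is at
least `-1`. -/
lemma lintegral_rpow_eq_top_of_tail (hμ : μ (Set.Iio 0) = 0)
    (htail : ∀ t, μ (Set.Ioi t) = ENNReal.ofReal (h t))
    (hlim : Tendsto (fun x => h x * x ^ α) atTop (𝓝 L)) (hL : 0 < L) (hp : 0 < p)
    (hpα : α ≤ p) :
    ∫⁻ w, ENNReal.ofReal (w ^ p) ∂μ = ⊤ := by
  rw [lintegral_rpow_eq_lintegral_meas_lt_mul μ (f := fun w => w)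
    (ae_nonneg_of_measure_Iio_zero hμ) aemeasurable_id hp]
  obtain ⟨N, hN⟩ := eventually_atTop.1
    ((hlim.eventually_const_lt (half_lt_self hL)).and (eventually_gt_atTop 0))
  have hN0 : 0 < N := (hN N le_rfl).2
  refine ENNReal.mul_eq_top.2 (Or.inl ⟨by simpa using hp, ?_⟩)
  have hI : ¬ IntegrableOn (fun t : ℝ => L / 2 * t ^ (p - 1 - α)) (Set.Ioi N) := by
    rw [IntegrableOn, integrable_const_mul_iff (by simpa using hL.ne')]
    intro hI
    have := (integrableOn_Ioi_rpow_iff hN0).1 hI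
    linarith
  have htop : ∫⁻ t in Set.Ioi N, ENNReal.ofReal (L / 2 * t ^ (p - 1 - α)) = ⊤ := by
    by_contra hne
    refine hI ((lintegral_ofReal_ne_top_iff_integrable
      (by fun_prop) ?_).1 hne)
    filter_upwards [ae_restrict_mem measurableSet_Ioi] with t ht
    have ht0 : 0 < t := hN0.trans ht
    have := Real.rpow_pos_of_pos ht0 (p - 1 - α)
    simp only [Pi.zero_apply]
    positivity
  rw [eq_top_iff, ← htop]
  refine le_trans (setLIntegral_mono_ae' measurableSet_Ioi (ae_of_all _ fun t ht => ?_))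
    (lintegral_mono_set (Set.Ioi_subset_Ioi hN0.le))
  obtain ⟨h1, ht0⟩ := hN t (le_of_lt ht)
  have htp := Real.rpow_pos_of_pos ht0 (p - 1)
  rw [show {a | t < a} = Set.Ioi t from rfl, htail, ← ENNReal.ofReal_mul' htp.le]
  refine ENNReal.ofReal_le_ofReal ?_
  have htα := Real.rpow_pos_of_pos ht0 α
  rw [Real.rpow_sub ht0 (p - 1) α, ← mul_div_assoc, div_le_iff₀ htα]
  nlinarith

lemma lintegral_excess (μ : Measure ℝ) (q : ℝ) :
    ∫⁻ w, ENNReal.ofReal (max (w - q) 0) ∂μ = ∫⁻ x in Set.Ioi q, μ (Set.Ioi x) := by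
  rw [lintegral_eq_lintegral_meas_lt μ (f := fun w : ℝ => max (w - q) 0)
    (ae_of_all _ fun w => le_max_right _ _)
    (by fun_prop)]
  rw [← (measurePreserving_add_left volume q).setLIntegral_comp_preimage_emb
    (measurableEmbedding_addLeft q) (fun x => μ (Set.Ioi x)) (Set.Ioi q)]
  simp only [Set.preimage_const_add_Ioi, sub_self]
  refine setLIntegral_congr_fun measurableSet_Ioi fun t ht => ?_
  have ht0 : (0 : ℝ) < t := ht
  congr 1
  ext w
  simp only [Set.mem_ofPred_eq, lt_max_iff, Set.mem_Ioi]
  constructor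
  · rintro (h | h) <;> linarith
  · intro h
    left
    linarith

end Moments

/-! ### Reconstructing a law from its expected excess. -/

section ExcessTransform

variable {f : ℝ → ℝ} {m : ℝ}

/-- A convex function that equals `m - q` for `q ≤ 0` and vanishes at infinity is the expected
excess of a probability distribution on the nonnegative half-line. -/
theorem ConvexOn.exists_measure_expectedExcess_eq (hf : ConvexOn ℝ Set.univ f)
    (hneg : ∀ q ≤ 0, f q = m - q) (h0 : Tendsto f atTop (𝓝 0)) :
    ∃ F : Measure ℝ, IsProbabilityMeasure F ∧ F (Set.Iio 0) = 0 ∧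
      (∀ x, cdf F x = 1 + derivWithin f (Set.Ioi x) x) ∧
      (∀ x, F (Set.Ioi x) = ENNReal.ofReal (-derivWithin f (Set.Ioi x) x)) ∧
      ∀ q, 0 ≤ f q ∧ Integrable (fun w : ℝ => max (w - q) 0) F ∧ expectedExcess F q = f q := by
  have hS := hf.add_rightDeriv_mul_le
  have hint : ∀ x, x ∈ interior (Set.univ : Set ℝ) := by simp
  -- A positive subgradient would give an affine minorant tending to infinity.
  have hd0 : ∀ x, derivWithin f (Set.Ioi x) x ≤ 0 := by
    intro x
    by_contra! hpos
    have h1 : Tendsto (fun y => f x + derivWithin f (Set.Ioi x) x * (y - x)) atTop atTop :=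
      tendsto_atTop_add_const_left _ _
        ((tendsto_atTop_add_const_right _ (-x) tendsto_id).const_mul_atTop hpos)
    exact not_tendsto_nhds_of_tendsto_atTop (tendsto_atTop_mono (hS x) h1) 0 h0
  have hfnn : ∀ x, 0 ≤ f x := by
    intro x
    refine le_of_tendsto h0 ?_
    filter_upwards [eventually_ge_atTop x] with y hy
    nlinarith [hS y x, hd0 y]
  have hdtop : Tendsto (fun x => derivWithin f (Set.Ioi x) x) atTop (𝓝 0) := by
    have h1 : Tendsto (fun x => f x - f (x - 1)) atTop (𝓝 0) := by
      simpa [sub_eq_add_neg] using h0.sub (h0.comp (tendsto_atTop_add_const_right _ (-1) tendsto_id))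
    exact tendsto_of_tendsto_of_tendsto_of_le_of_le h1 tendsto_const_nhds
      (fun x => by linarith [hS x (x - 1)]) hd0
  have hdneg : ∀ x < 0, derivWithin f (Set.Ioi x) x = -1 := by
    intro x hx
    have h1 := hS x (x - 1)
    have h2 := hS x (x / 2)
    rw [hneg x hx.le, hneg _ (by linarith)] at h1 h2
    refine le_antisymm ?_ (by linarith)
    nlinarith
  let G : StieltjesFunction ℝ :=
    { toFun := fun x => 1 + derivWithin f (Set.Ioi x) x
      mono' := fun x y hxy =>
        add_le_add_right (hf.monotoneOn_rightDeriv (hint x) (hint y) hxy) 1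
      right_continuous' := fun x =>
        continuousWithinAt_const.add (hf.continuousWithinAt_rightDeriv x) }
  have hG : ∀ x, G x = 1 + derivWithin f (Set.Ioi x) x := fun _ => rfl
  have hGbot : Tendsto G atBot (𝓝 0) := by
    refine tendsto_const_nhds.congr' ?_
    filter_upwards [eventually_lt_atBot 0] with x hx
    rw [hG, hdneg x hx]; norm_num
  have hGtop : Tendsto G atTop (𝓝 1) := by simpa using hdtop.const_add 1
  have hP : IsProbabilityMeasure G.measure := G.isProbabilityMeasure hGbot hGtop
  have htail : ∀ x, G.measure (Set.Ioi x) = ENNReal.ofReal (-derivWithin f (Set.Ioi x) x) := by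
    intro x
    rw [G.measure_Ioi hGtop, hG]
    congr 1; ring
  refine ⟨G.measure, hP, ?_, fun x => ?_, htail, fun q => ⟨hfnn q, ?_⟩⟩
  -- Only the left limit at `0` must vanish; an atom at `0` is allowed.
  · rw [G.measure_Iio hGbot, sub_zero]
    have : Function.leftLim G 0 = 0 := by
      refine tendsto_nhds_unique (G.mono.tendsto_leftLim 0) ?_
      refine tendsto_const_nhds.congr' ?_
      filter_upwards [self_mem_nhdsWithin] with x hx
      rw [hG, hdneg x hx]; norm_num
    simp [this]
  · rw [cdf_measure_stieltjesFunction G hGbot hGtop, hG]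
  · have hL : ∫⁻ w, ENNReal.ofReal (max (w - q) 0) ∂G.measure = ENNReal.ofReal (f q) := by
      rw [lintegral_excess, ← hf.lintegral_Ioi_neg_rightDeriv hd0 h0 q]
      simp only [htail]
    have hnn : 0 ≤ᵐ[G.measure] fun w : ℝ => max (w - q) 0 := ae_of_all _ fun w => le_max_right _ _
    have hm : AEStronglyMeasurable (fun w : ℝ => max (w - q) 0) G.measure := by fun_prop
    refine ⟨(lintegral_ofReal_ne_top_iff_integrable hm hnn).1 (hL ▸ ENNReal.ofReal_ne_top), ?_⟩
    rw [expectedExcess, integral_eq_lintegral_of_nonneg_ae hnn hm, hL,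
      ENNReal.toReal_ofReal (hfnn q)]

end ExcessTransform

theorem theorem3 (α m₁ mα : ℝ) (hα : 1 < α) (hm₁ : 0 < m₁)
    (hmα : m₁ ^ α < mα) :
    -- (a), with the supremum being a genuine (finite, nonempty) one
    ((∀ q : ℝ, 0 ≤ q →
        IsLUB ((fun F => expectedExcess F q) '' ambiguitySet m₁ α mα) (worstCase m₁ α mα q)) ∧
      RegularlyVarying (worstCase m₁ α mα) (-(α - 1))) ∧
    -- (b)
    ∃ Fstar : Measure ℝ, IsProbabilityMeasure Fstar ∧ Fstar (Set.Iio 0) = 0 ∧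
      Fstar ∉ ambiguitySet m₁ α mα ∧
      (∀ q : ℝ, 0 ≤ q → Integrable (fun w : ℝ => max (w - q) 0) Fstar ∧
        expectedExcess Fstar q = worstCase m₁ α mα q) ∧
      RegularlyVarying (fun x => 1 - cdf Fstar x) (-α) ∧
      (∀ α₁ : ℝ, 0 ≤ α₁ → α₁ < α → ∫⁻ w, ENNReal.ofReal (w ^ α₁) ∂Fstar < ⊤) ∧
      (∀ α₁ : ℝ, α ≤ α₁ → ∫⁻ w, ENNReal.ofReal (w ^ α₁) ∂Fstar = ⊤) := by
  have hne := ambiguitySet_nonempty hα hm₁ hmα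
  have hW := tendsto_worstCase_mul_rpow hα hm₁ hmα
  have hK : 0 < (mα - m₁ ^ α) * excessConstant α :=
    mul_pos (by linarith) (excessConstant_pos hα)
  have hconv := convexOn_worstCase hne
  have hW0 : Tendsto (worstCase m₁ α mα) atTop (𝓝 0) := by
    have h1 : Tendsto (fun q : ℝ => q ^ (-(α - 1))) atTop (𝓝 0) :=
      tendsto_rpow_neg_atTop (by linarith)
    have h2 := hW.mul h1
    rw [mul_zero] at h2
    refine h2.congr' ?_
    filter_upwards [eventually_gt_atTop 0] with q hq
    rw [mul_assoc, ← Real.rpow_add hq, add_neg_cancel, Real.rpow_zero, mul_one]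
  refine ⟨⟨fun q _ => isLUB_worstCase hne q,
    regularlyVarying_of_tendsto_mul_rpow hK.ne' (fun q _ => worstCase_nonneg m₁ α mα q)
      (by simpa using hW)⟩, ?_⟩
  obtain ⟨F, hP, hF0, hcdf, htail, hexc⟩ :=
    hconv.exists_measure_expectedExcess_eq (fun q hq => worstCase_of_nonpos hne hq) hW0
  have hdens := tendsto_subgradient_mul_rpow hconv.add_rightDeriv_mul_le hW
  rw [sub_add_cancel] at hdens
  have hL : 0 < (mα - m₁ ^ α) * excessConstant α * (α - 1) := mul_pos hK (by linarith)
  have htop : ∀ α₁ : ℝ, α ≤ α₁ → ∫⁻ w, ENNReal.ofReal (w ^ α₁) ∂F = ⊤ := fun α₁ h =>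
    lintegral_rpow_eq_top_of_tail hF0 htail hdens hL (by linarith) h
  refine ⟨F, hP, hF0, fun hmem => ?_, fun q _ => (hexc q).2, ?_, fun α₁ h1 h2 =>
    lintegral_rpow_lt_top_of_tail hF0 htail hdens h1 h2, htop⟩
  · exact hmem.2.2.2.1.lintegral_lt_top.ne (htop α le_rfl)
  · refine regularlyVarying_of_tendsto_mul_rpow hL.ne'
      (fun x _ => sub_nonneg.2 (cdf_le_one F x)) ?_
    refine hdens.congr fun x => ?_
    rw [hcdf, neg_neg]; ring
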